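/- **Setting.** Let $\mathbb E$ be a finite set of base stations, $c$ the cloud, $\mathbb S$ a finite set of services; $n$ ranges over $\mathbb E\cup\{c\}$. Given are link indicators $l_{en}\in\{0,1\}$; nonnegative capacities $C_e,B_e,M_e,B^l_{en}$, propagation delays $d^{\rm prp}_{en}$, request rates $\lambda_{es}$, sizes $\sigma_s,\beta_s$, target delays $D^{\max}_s$ and unit prices $p^{\rm cpu}_n,p^{\rm str}_n,p^{\rm trn}_{en}$; numbers $\nu_s>0$ and $\alpha\in[0,1]$; functions $R_{ns}:[0,\infty)\to\mathbb R$ that are twice continuously differentiable, concave and increasing (in the weak sense); and a set $T\subseteq\mathbb S$ of services that are permanently stored in the cloud (if the cloud holds every service, $T=\mathbb S$). The complicating variables are binary, $(X,Z)\in D_{X,Z}$, with $X=(x_{ns})$, $Z=(z_{sen})$; the simple variables are $(Y,U)\in D_{Y,U}$, i.e. $y_{sen}\in[0,1]$, $u_{ns}\in[0,\infty)$. Put $\Lambda_{ns}=\sum_e\lambda_{es}y_{sen}$, $\Lambda^l_{en}=\sum_s\beta_s\lambda_{es}y_{sen}$, $$F(Y,U)=\sum_{s,n}R_{ns}(\Lambda_{ns})-\sum_{s,n}p^{\rm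 cpu}_nu_{ns}-\sum_{e,n}p^{\rm trn}_{en}\Lambda^l_{en},\qquad \mathcal P_{\rm str}(X)=\sum_s\sigma_s\sum_np^{\rm str}_nx_{ns}.$$ Let $G(X,Z,Y,U)\ge 0$ denote the system of constraints 1. $\sum_ny_{sen}\le1$; $\ \sum_s\beta_s\sum_n\lambda_{es}y_{sen}\le B_e$; $\ \sum_su_{es}\le M_e$; $\ \Lambda_{ns}\le u_{ns}/\nu_s$; $\ \Lambda^l_{en}\le B^l_{en}$ ($n\ne e$); 2. $z_{see}\le D^{\max}_s(u_{es}/\nu_s-\Lambda_{es})$; and, for $n\neq e$, $z_{sen}\le(1-\alpha)D^{\max}_s(u_{ns}/\nu_s-\Lambda_{ns})$ and $z_{sen}\le\max\{\alpha D^{\max}_s-d^{\rm prp}_{en},0\}(B^l_{en}-\Lambda^l_{en})$; and $y_{sen}\le z_{sen}$, each component of $G$ being the right-hand side minus the left-hand side of one of these inequalities. Call $(X,Z)$ admissible if $\sum_s\sigma_sx_{es}\le C_e$ for all $e$, $z_{sen}\le x_{ns}l_{en}$ for all $s,e,n$, and $x_{cs}=1$ for $s\in T$. The *reformulated problem* is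 to maximize $F(Y,U)-\mathcal P_{\rm str}(X)$ over admissible $(X,Z)\in D_{X,Z}$ and $(Y,U)\in D_{Y,U}$ with $G\ge0$. Write $f(X,Z)=\sup\{F(Y,U):(Y,U)\in D_{Y,U},\ G(X,Z,Y,U)\ge0\}$ for the value of the inner problem ($-\infty$ if it is infeasible). **Algorithm.** Fix $\epsilon\ge0$. Pick any $(\hat X,\hat Z)\in D_{X,Z}$ and set $\mathsf{UB}=+\infty$, $\mathsf{LB}=-\infty$, with no cuts. Iterate: * If $\mathsf{UB}-\epsilon\le f(\hat X,\hat Z)-\mathcal P_{\rm str}(\hat X)<\infty$, stop and output $(\hat X,\hat Z)$ with an optimal solution $(\hat Y,\hat U)$ of the inner problem. * If $-\infty<f(\hat X,\hat Z)-\mathcal P_{\rm str}(\hat X)<\mathsf{UB}-\epsilon$, take an optimal solution $(\hat Y,\hat U)$ of the inner problem and a corresponding vector $\hat\mu\ge0$ of Lagrange multipliers, replace $\mathsf{LB}$ by $\max\{\mathsf{LB},f(\hat X,\hat Z)-\mathcal P_{\rm str}(\hat X)\}$, and add the optimality cut $\mathsf{UB}\le L^*(X,Z)$, where $L^*(X,Z)=F(\hat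 Y,\hat U)-\mathcal P_{\rm str}(X)+\sum_i\hat\mu_iG_i(X,Z,\hat Y,\hat U)$, the sum being over the constraints of group 2. * If $f(\hat X,\hat Z)=-\infty$, take an optimal solution $(\bar\gamma,\bar Y,\bar U)$ of $\min\{\gamma:\gamma\in\mathbb R,\ (Y,U)\in D_{Y,U},\ G(\hat X,\hat Z,Y,U)+\gamma\mathbf 1\ge0\}$ with a corresponding vector $\hat\lambda\ge0$ of Lagrange multipliers, and add the feasibility cut $L_*(X,Z)=\hat\lambda^{T}G(X,Z,\bar Y,\bar U)\ge0$. * In the last two cases solve the relaxed master problem: maximize $\mathsf{UB}\in[-\infty,\infty]$ over $\mathsf{UB}$ and admissible $(X,Z)\in D_{X,Z}$ subject to all cuts so far. Its optimal solution is the new $(\mathsf{UB},\hat X,\hat Z)$. **Theorem 2 (Finite convergence to the global optimal solution).** For every $\epsilon\ge0$ the algorithm terminates after finitely many iterations, whichever initial point, optimal solutions and multipliers are chosen: all subproblems that occur are solvable (with multipliers), and the number of iterations is bounded by a number that does not depend on these choices. On termination the output $(X^*,Z^*,Y^*,U^*)$ is feasible for the reformulated problem, and the optimal value of that problem is at most $\mathsf{UB}$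 and exceeds the objective value of the output by at most $\epsilon$. In particular, for $\epsilon=0$ the output is a global optimal solution of the reformulated problem and $\mathsf{UB}$ equals its optimal value. -/

import Mathlib

noncomputable section

namespace MEC

/-- Servers: `some e` is the base station `e`, `none` is the cloud `c`. -/
abbrev Server (E : ℕ) := Option (Fin E)

/-- Pairs `(e, n)` of a base station and a server with `n ≠ e`. -/
abbrev OffLink (E : ℕ) := {p : Fin E × Server E // p.2 ≠ some p.1}

/-- The parameters of the placement, scheduling and CPU sizing problem with `E` base stations
and `S` services. -/
structure Params (E S : ℕ) where
  /-- `l e n`: are `e` and `n` directly connected? -/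
  l : Fin E → Server E → Bool
  /-- storage capacities -/
  C : Fin E → ℝ
  /-- communication capacities of the base stations -/
  B : Fin E → ℝ
  /-- computation capacities -/
  M : Fin E → ℝ
  /-- link bandwidths (used for `n ≠ e` only) -/
  Bl : Fin E → Server E → ℝ
  /-- propagation delays -/
  dprp : Fin E → Server E → ℝ
  /-- request rates -/
  lam : Fin E → Fin S → ℝ
  /-- storage size per replica -/
  sigma : Fin S → ℝ
  /-- data size per request -/
  beta : Fin S → ℝ
  /-- mean computation requirement per request -/
  nu : Fin S → ℝ
  /-- target delays -/
  Dmax : Fin S → ℝ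
  /-- unit costs of CPU, storage and traffic -/
  pcpu : Server E → ℝ
  pstr : Server E → ℝ
  ptrn : Fin E → Server E → ℝ
  /-- splitting of the target delay between service and network -/
  alpha : ℝ
  /-- revenue functions of the request rate served -/
  R : Server E → Fin S → ℝ → ℝ
  /-- services that are permanently stored in the cloud: `x c s = 1` is imposed for these -/
  T : Set (Fin S)
  C_nonneg : ∀ e, 0 ≤ C e
  B_nonneg : ∀ e, 0 ≤ B e
  M_nonneg : ∀ e, 0 ≤ M e
  Bl_nonneg : ∀ e n, 0 ≤ Bl e n
  dprp_nonneg : ∀ e n, 0 ≤ dprp e n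
  lam_nonneg : ∀ e s, 0 ≤ lam e s
  sigma_nonneg : ∀ s, 0 ≤ sigma s
  beta_nonneg : ∀ s, 0 ≤ beta s
  nu_pos : ∀ s, 0 < nu s
  Dmax_nonneg : ∀ s, 0 ≤ Dmax s
  pcpu_nonneg : ∀ n, 0 ≤ pcpu n
  pstr_nonneg : ∀ n, 0 ≤ pstr n
  ptrn_nonneg : ∀ e n, 0 ≤ ptrn e n
  alpha_mem : alpha ∈ Set.Icc (0 : ℝ) 1
  R_contDiff : ∀ n s, ContDiffOn ℝ 2 (R n s) (Set.Ici 0)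
  R_concave : ∀ n s, ConcaveOn ℝ (Set.Ici 0) (R n s)
  R_mono : ∀ n s, MonotoneOn (R n s) (Set.Ici 0)

/-- The numerical value of a binary variable. -/
def bit (b : Bool) : ℝ := if b then 1 else 0

/-- The complicating (binary) variables `(X, Z)`; the type is the domain `D_{X,Z}`. -/
structure Compl (E S : ℕ) where
  x : Server E → Fin S → Bool
  z : Fin S → Fin E → Server E → Bool

/-- The simple (continuous) variables `(Y, U)`. -/
structure Simp (E S : ℕ) where
  y : Fin S → Fin E → Server E → ℝ
  u : Server E → Fin S → ℝ

/-- The domain `D_{Y,U}`: `y` has entries in `[0, 1]` and `u` has entries in `[0, ∞)`. -/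
def simpDom (E S : ℕ) : Set (Simp E S) :=
  {w | (∀ s e n, w.y s e n ∈ Set.Icc (0 : ℝ) 1) ∧ ∀ n s, 0 ≤ w.u n s}

/-- Indices of the scalar constraints collected in the vector `G`. -/
inductive Con (E S : ℕ)
  | admission (s : Fin S) (e : Fin E)
  | bandwidth (e : Fin E)
  | cpu (e : Fin E)
  | nodeStability (n : Server E) (s : Fin S)
  | linkStability (p : OffLink E)
  | localDelay (s : Fin S) (e : Fin E)
  | remoteDelay (s : Fin S) (p : OffLink E)
  | networkDelay (s : Fin S) (p : OffLink E)
  | transfer (s : Fin S) (e : Fin E) (n : Server E)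
  deriving Fintype

variable {E S : ℕ}

namespace Params

/-- Total request rate for service `s` at server `n`. -/
def Lam (P : Params E S) (w : Simp E S) (n : Server E) (s : Fin S) : ℝ :=
  ∑ e, P.lam e s * w.y s e n

/-- Total traffic on the link `(e, n)`. -/
def LamL (P : Params E S) (w : Simp E S) (e : Fin E) (n : Server E) : ℝ :=
  ∑ s, P.beta s * P.lam e s * w.y s e n

/-- Serving revenue. -/
def revenue (P : Params E S) (w : Simp E S) : ℝ := ∑ s, ∑ n, P.R n s (P.Lam w n s)

/-- CPU cost. -/
def cpuCost (P : Params E S) (w : Simp E S) : ℝ := ∑ s, ∑ n, P.pcpu n * w.u n s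

/-- Transmission cost. -/
def trnCost (P : Params E S) (w : Simp E S) : ℝ := ∑ e, ∑ n, P.LamL w e n * P.ptrn e n

/-- Storage cost. -/
def strCost (P : Params E S) (c : Compl E S) : ℝ :=
  ∑ s, P.sigma s * ∑ n, P.pstr n * bit (c.x n s)

/-- Objective of the inner problem. -/
def innerObj (P : Params E S) (w : Simp E S) : ℝ := P.revenue w - P.cpuCost w - P.trnCost w

/-- Total profit. -/
def profit (P : Params E S) (c : Compl E S) (w : Simp E S) : ℝ := P.innerObj w - P.strCost c

/-- The vector `G(X, Z, Y, U)` of constraint functions; the constraint is `G ≥ 0`. -/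
def G (P : Params E S) (c : Compl E S) (w : Simp E S) : Con E S → ℝ
  | .admission s e => 1 - ∑ n, w.y s e n
  | .bandwidth e => P.B e - ∑ s, P.beta s * ∑ n, P.lam e s * w.y s e n
  | .cpu e => P.M e - ∑ s, w.u (some e) s
  | .nodeStability n s => w.u n s / P.nu s - P.Lam w n s
  | .linkStability p => P.Bl p.1.1 p.1.2 - P.LamL w p.1.1 p.1.2
  | .localDelay s e =>
      P.Dmax s * (w.u (some e) s / P.nu s - P.Lam w (some e) s) - bit (c.z s e (some e))
  | .remoteDelay s p =>
      (1 - P.alpha) * P.Dmax s * (w.u p.1.2 s / P.nu s - P.Lam w p.1.2 s)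
        - bit (c.z s p.1.1 p.1.2)
  | .networkDelay s p =>
      max (P.alpha * P.Dmax s - P.dprp p.1.1 p.1.2) 0
          * (P.Bl p.1.1 p.1.2 - P.LamL w p.1.1 p.1.2)
        - bit (c.z s p.1.1 p.1.2)
  | .transfer s e n => bit (c.z s e n) - w.y s e n

/-- The constraints on the complicating variables alone: storage, `z ≤ x l`, and the services
permanently stored in the cloud. -/
def ComplFeasible (P : Params E S) (c : Compl E S) : Prop :=
  (∀ e, ∑ s, P.sigma s * bit (c.x (some e) s) ≤ P.C e) ∧
  (∀ s e n, bit (c.z s e n) ≤ bit (c.x n s) * bit (P.l e n)) ∧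
  ∀ s ∈ P.T, c.x none s = true

/-- Feasibility for the reformulated problem. -/
def Feasible (P : Params E S) (c : Compl E S) (w : Simp E S) : Prop :=
  P.ComplFeasible c ∧ w ∈ simpDom E S ∧ ∀ i, 0 ≤ P.G c w i

/-- `(c, w)` is a global optimal solution of the reformulated problem. -/
def IsGlobalOptimum (P : Params E S) (c : Compl E S) (w : Simp E S) : Prop :=
  P.Feasible c w ∧ ∀ c' w', P.Feasible c' w' → P.profit c' w' ≤ P.profit c w

/-- Feasible set of the inner problem at `c`. -/
def innerSet (P : Params E S) (c : Compl E S) : Set (Simp E S) :=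
  {w | w ∈ simpDom E S ∧ ∀ i, 0 ≤ P.G c w i}

/-- Optimal value `f(X, Z)` of the inner problem (`⊥` if it is infeasible). -/
def innerVal (P : Params E S) (c : Compl E S) : EReal :=
  ⨆ w ∈ P.innerSet c, (P.innerObj w : EReal)

/-- `w` is an optimal solution of the inner problem at `c`, with `mu` a corresponding vector of
Lagrange multipliers: dual feasibility, maximization of the Lagrangian over `D_{Y,U}`, and
complementary slackness. -/
structure InnerSolved (P : Params E S) (c : Compl E S) (w : Simp E S) (mu : Con E S → ℝ) :
    Prop where
  mem : w ∈ P.innerSet c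
  isMax : IsMaxOn P.innerObj (P.innerSet c) w
  nonneg : ∀ i, 0 ≤ mu i
  lagrangian : IsMaxOn (fun w' => P.innerObj w' + ∑ i, mu i * P.G c w' i) (simpDom E S) w
  slackness : ∀ i, mu i * P.G c w i = 0

/-- Feasible pairs `(γ, (Y, U))` of the feasibility problem `min γ` s.t. `G + γ 1 ≥ 0`. -/
def feasSet (P : Params E S) (c : Compl E S) : Set (ℝ × Simp E S) :=
  {q | q.2 ∈ simpDom E S ∧ ∀ i, 0 ≤ P.G c q.2 i + q.1}

/-- `(g, w)` is an optimal solution of the feasibility problem at `c`, with `lm` a corresponding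
vector of Lagrange multipliers; as `γ` is a free variable, `∑ i, lm i = 1` follows. -/
structure FeasSolved (P : Params E S) (c : Compl E S) (g : ℝ) (w : Simp E S)
    (lm : Con E S → ℝ) : Prop where
  mem : (g, w) ∈ P.feasSet c
  isMin : IsMinOn Prod.fst (P.feasSet c) (g, w)
  nonneg : ∀ i, 0 ≤ lm i
  lagrangian : IsMinOn (fun q : ℝ × Simp E S => q.1 - ∑ i, lm i * (P.G c q.2 i + q.1))
    (Set.univ ×ˢ simpDom E S) (g, w)
  slackness : ∀ i, lm i * (P.G c w i + g) = 0

/-- The optimality cut function `L^*(X, Z; μ)` in its explicit form, from the optimal solution `w`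
of an inner problem and its multipliers `mu`. -/
def LUpper (P : Params E S) (w : Simp E S) (mu : Con E S → ℝ) (c : Compl E S) : ℝ :=
  P.innerObj w - P.strCost c
    + ∑ s, ∑ e, mu (.localDelay s e) * P.G c w (.localDelay s e)
    + ∑ s, ∑ p, mu (.remoteDelay s p) * P.G c w (.remoteDelay s p)
    + ∑ s, ∑ p, mu (.networkDelay s p) * P.G c w (.networkDelay s p)
    + ∑ s, ∑ e, ∑ n, mu (.transfer s e n) * P.G c w (.transfer s e n)

/-- The feasibility cut function `L_*(X, Z; λ)` in its explicit form, from the optimal solution `w`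
of a feasibility problem and its multipliers `lm`. -/
def LLower (P : Params E S) (w : Simp E S) (lm : Con E S → ℝ) (c : Compl E S) : ℝ :=
  ∑ i, lm i * P.G c w i

end Params

/-- The data defining a cut: continuous variables and a multiplier vector. -/
abbrev CutData (E S : ℕ) := Simp E S × (Con E S → ℝ)

/-- State of the algorithm at the beginning of an iteration. The counters `τ^feas` and `τ^infeas`
are the lengths of the two lists of cuts. -/
structure State (E S : ℕ) where
  c : Compl E S
  UB : EReal
  LB : EReal
  optCuts : List (CutData E S)
  feasCuts : List (CutData E S)

/-- Initial states: an arbitrary element of `D_{X,Z}`, trivial bounds, no cuts. -/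
def State.IsInitial (st : State E S) : Prop :=
  st.UB = ⊤ ∧ st.LB = ⊥ ∧ st.optCuts = [] ∧ st.feasCuts = []

namespace Params

/-- Feasibility of `(UB, X, Z)` for the relaxed master problem with the given cuts. -/
def MasterFeasible (P : Params E S) (oc fc : List (CutData E S)) (ub : EReal)
    (c : Compl E S) : Prop :=
  P.ComplFeasible c ∧ (∀ k ∈ oc, ub ≤ (P.LUpper k.1 k.2 c : EReal)) ∧
    ∀ k ∈ fc, 0 ≤ P.LLower k.1 k.2 c

/-- `(UB, X, Z)` is an optimal solution of the relaxed master problem (`UB = ⊤` as long as there is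
no optimality cut). -/
def MasterSolved (P : Params E S) (oc fc : List (CutData E S)) (ub : EReal)
    (c : Compl E S) : Prop :=
  P.MasterFeasible oc fc ub c ∧ ∀ ub' c', P.MasterFeasible oc fc ub' c' → ub' ≤ ub

/-- One iteration that does not stop: the inner problem yields an optimality or a feasibility cut,
and the relaxed master problem is solved. Solvers may return any optimal solution and any
corresponding multipliers. -/
inductive Step (P : Params E S) (ε : ℝ) : State E S → State E S → Prop
  | optimality (st : State E S) (w : Simp E S) (mu : Con E S → ℝ) (ub : EReal) (c : Compl E S)
      (solved : P.InnerSolved st.c w mu)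
      (feas : ⊥ < P.innerVal st.c)
      (gap : P.innerVal st.c - (P.strCost st.c : EReal) < st.UB - (ε : EReal))
      (master : P.MasterSolved ((w, mu) :: st.optCuts) st.feasCuts ub c) :
      Step P ε st
        { c := c
          UB := ub
          LB := max st.LB (P.innerVal st.c - (P.strCost st.c : EReal))
          optCuts := (w, mu) :: st.optCuts
          feasCuts := st.feasCuts }
  | feasibility (st : State E S) (g : ℝ) (w : Simp E S) (lm : Con E S → ℝ) (ub : EReal)
      (c : Compl E S)
      (infeas : P.innerVal st.c = ⊥)
      (solved : P.FeasSolved st.c g w lm)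
      (master : P.MasterSolved st.optCuts ((w, lm) :: st.feasCuts) ub c) :
      Step P ε st
        { c := c
          UB := ub
          LB := st.LB
          optCuts := st.optCuts
          feasCuts := (w, lm) :: st.feasCuts }

/-- The algorithm stops in the state `st` and returns `(c, w)`. -/
def Halts (P : Params E S) (ε : ℝ) (st : State E S) (c : Compl E S) (w : Simp E S) : Prop :=
  c = st.c ∧ (∃ mu, P.InnerSolved st.c w mu) ∧
    st.UB - (ε : EReal) ≤ P.innerVal st.c - (P.strCost st.c : EReal) ∧ P.innerVal st.c < ⊤

/-- `run 0, …, run k` is an execution with `k` iterations that do not stop. -/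
def IsRun (P : Params E S) (ε : ℝ) (k : ℕ) (run : ℕ → State E S) : Prop :=
  (run 0).IsInitial ∧ ∀ i < k, P.Step ε (run i) (run (i + 1))

end Params

end MEC

end

/-! The argument is generalized Benders decomposition over finitely many binary points, with strong
duality for each subproblem.

Each component of `G` is affine in the simple variables, and the inner objective is concave and
differentiable on the polyhedron `simpDom`. Farkas' lemma therefore yields Lagrange multipliers
without a Slater condition (`exists_lagrange_multipliers`). Inner optima exist because the CPU
variables can be capped, which reduces the problem to a compact set (`exists_isMaxOn_innerObj`); the
feasibility problem is a bounded linear program (`exists_isMax_of_linear`).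

Since `G` is a sum of a function of the complicating variables and a function of the simple ones
(`G_separable`), a point `w` optimal for the Lagrangian at one binary point is optimal for it at
every other, with the same multipliers. Hence every cut is globally valid (`InnerSolved.profit_le`,
`FeasSolved.LLower_nonneg`), so `UB` always bounds the optimal profit. By complementary slackness an
optimality cut is exact, and a feasibility cut violated, at the point that generated it
(`InnerSolved.LUpper_self`, `FeasSolved.LLower_self`). If the master problem returns to a point
already cut, the former forces the stopping test to succeed and the latter is impossible. So
non-stopping iterations visit distinct binary points, and their number is at most the cardinality of
`Compl E S`. -/

section Polyhedra

/-! ### Linear and concave programming over polyhedra. -/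

open Finset

/-- **Farkas' lemma** for finite families of linear functionals. -/
theorem exists_nonneg_combination_of_forall_nonneg {V ι : Type*} [AddCommGroup V] [Module ℝ V]
    (s : Finset ι) (f : ι → V →ₗ[ℝ] ℝ) (g : V →ₗ[ℝ] ℝ)
    (h : ∀ x, (∀ i ∈ s, 0 ≤ f i x) → 0 ≤ g x) :
    ∃ a : ι → ℝ, (∀ i, 0 ≤ a i) ∧ ∀ x, g x = ∑ i ∈ s, a i * f i x := by
  classical
  induction s using Finset.induction_on generalizing f g with
  | empty =>
    refine ⟨0, fun _ => le_rfl, fun x => ?_⟩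
    have h1 := h x (by simp)
    have h2 := h (-x) (by simp)
    rw [map_neg] at h2
    simp only [sum_empty]
    linarith
  | insert k s hk ih =>
    by_cases hs : ∀ x, (∀ i ∈ s, 0 ≤ f i x) → 0 ≤ g x
    · obtain ⟨a, ha, hga⟩ := ih f g hs
      refine ⟨Function.update a k 0, fun i => ?_, fun x => ?_⟩
      · by_cases hi : i = k
        · simp [hi]
        · simpa [hi] using ha i
      · rw [sum_insert hk, hga x, Function.update_self, zero_mul, zero_add]
        refine sum_congr rfl fun i hi => ?_
        rw [Function.update_of_ne (ne_of_mem_of_not_mem hi hk)]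
    · push Not at hs
      obtain ⟨y, hy, hgy⟩ := hs
      have hky : f k y < 0 := by
        by_contra hc
        refine absurd (h y fun i hi => ?_) (not_le.2 hgy)
        rcases mem_insert.1 hi with rfl | hi
        · exact not_lt.1 hc
        · exact hy i hi
      -- With this `r`, the map `x ↦ x + (r * f k x) • y` is the projection onto the kernel of `f k`
      -- along `y`. The induction hypothesis is applied to the functionals composed with this
      -- projection; collecting the multiples of `f k` in the result gives the coefficient `b`
      -- below.
      set r : ℝ := -(f k y)⁻¹ with hr
      have hr0 : 0 < r := by rw [hr]; simpa using hky
      have hrk : r * f k y = -1 := by rw [hr, neg_mul, inv_mul_cancel₀ hky.ne]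
      obtain ⟨a, ha, hga⟩ := ih (fun i => f i + (r * f i y) • f k) (g + (r * g y) • f k) (by
        intro x hx
        have := h (x + (r * f k x) • y) (by
          intro i hi
          rcases mem_insert.1 hi with rfl | hi
          · simp only [map_add, map_smul, smul_eq_mul]
            have : f i x + r * f i x * f i y = f i x * (1 + r * f i y) := by ring
            rw [this, hrk]; simp
          · have := hx i hi
            simp only [LinearMap.add_apply, LinearMap.smul_apply, smul_eq_mul] at this
            simp only [map_add, map_smul, smul_eq_mul]
            linarith)
        simp only [map_add, map_smul, smul_eq_mul] at this
        simp only [LinearMap.add_apply, LinearMap.smul_apply, smul_eq_mul]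
        linarith)
      set b : ℝ := ∑ i ∈ s, a i * (r * f i y) - r * g y with hb
      have hb0 : 0 ≤ b := by
        have h1 : 0 ≤ ∑ i ∈ s, a i * (r * f i y) :=
          sum_nonneg fun i hi => mul_nonneg (ha i) (mul_nonneg hr0.le (hy i hi))
        have h2 : r * g y ≤ 0 := mul_nonpos_of_nonneg_of_nonpos hr0.le hgy.le
        linarith
      refine ⟨Function.update a k b, fun i => ?_, fun x => ?_⟩
      · by_cases hi : i = k
        · simp [hi, hb0]
        · simpa [hi] using ha i
      · rw [sum_insert hk, Function.update_self]
        have h1 : ∑ i ∈ s, Function.update a k b i * f i x = ∑ i ∈ s, a i * f i x :=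
          sum_congr rfl fun i hi => by
            rw [Function.update_of_ne (ne_of_mem_of_not_mem hi hk)]
        have h2 := hga x
        simp only [LinearMap.add_apply, LinearMap.smul_apply, smul_eq_mul, mul_add,
          sum_add_distrib] at h2
        have h3 : ∑ i ∈ s, a i * (r * f i y * f k x) = (∑ i ∈ s, a i * (r * f i y)) * f k x := by
          rw [sum_mul]; exact sum_congr rfl fun i _ => by ring
        rw [h1, hb]
        rw [h3] at h2
        linarith

/-- A real function that is the sum of a linear functional and a constant. -/
def IsAffineFun {V : Type*} [AddCommGroup V] [Module ℝ V] (g : V → ℝ) : Prop :=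
  ∃ (f : V →ₗ[ℝ] ℝ) (b : ℝ), ∀ x, g x = f x + b

namespace IsAffineFun

variable {V : Type*} [AddCommGroup V] [Module ℝ V] {g h : V → ℝ}

theorem of_linear (f : V →ₗ[ℝ] ℝ) : IsAffineFun (fun x => f x) := ⟨f, 0, by simp⟩

theorem const (b : ℝ) : IsAffineFun (fun _ : V => b) := ⟨0, b, by simp⟩

theorem add (hg : IsAffineFun g) (hh : IsAffineFun h) : IsAffineFun (fun x => g x + h x) := by
  obtain ⟨f, b, hf⟩ := hg
  obtain ⟨f', b', hf'⟩ := hh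
  exact ⟨f + f', b + b', fun x => by simp only [hf, hf', LinearMap.add_apply]; ring⟩

theorem const_mul (r : ℝ) (hg : IsAffineFun g) : IsAffineFun (fun x => r * g x) := by
  obtain ⟨f, b, hf⟩ := hg
  exact ⟨r • f, r * b, fun x => by simp only [hf, LinearMap.smul_apply, smul_eq_mul]; ring⟩

theorem mul_const (r : ℝ) (hg : IsAffineFun g) : IsAffineFun (fun x => g x * r) := by
  simpa only [mul_comm] using hg.const_mul r

theorem div_const (r : ℝ) (hg : IsAffineFun g) : IsAffineFun (fun x => g x / r) := by
  simpa only [div_eq_mul_inv] using hg.mul_const r⁻¹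

theorem neg (hg : IsAffineFun g) : IsAffineFun (fun x => -g x) := by
  simpa using hg.const_mul (-1)

theorem sub (hg : IsAffineFun g) (hh : IsAffineFun h) : IsAffineFun (fun x => g x - h x) := by
  simpa only [sub_eq_add_neg] using hg.add hh.neg

theorem sum {ι : Type*} {s : Finset ι} {g : ι → V → ℝ} (hg : ∀ i, IsAffineFun (g i)) :
    IsAffineFun (fun x => ∑ i ∈ s, g i x) := by
  classical
  induction s using Finset.induction_on with
  | empty => simpa using const 0
  | insert k s hk ih => simpa only [sum_insert hk] using (hg k).add ih

theorem comp_linear {W : Type*} [AddCommGroup W] [Module ℝ W] (hg : IsAffineFun g)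
    (f : W →ₗ[ℝ] V) : IsAffineFun (fun x => g (f x)) := by
  obtain ⟨f', b, hf⟩ := hg
  exact ⟨f' ∘ₗ f, b, fun x => hf _⟩

end IsAffineFun

/-- A maximizer of a linear functional over a polyhedron has Lagrange multipliers. -/
theorem exists_multipliers_of_linear {V ι : Type*} [AddCommGroup V] [Module ℝ V] [Fintype ι]
    {g : ι → V → ℝ} (hg : ∀ i, IsAffineFun (g i)) (φ : V →ₗ[ℝ] ℝ) {v : V}
    (hv : ∀ i, 0 ≤ g i v) (hmax : ∀ x, (∀ i, 0 ≤ g i x) → φ x ≤ φ v) :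
    ∃ a : ι → ℝ, (∀ i, 0 ≤ a i) ∧ (∀ i, a i * g i v = 0) ∧
      ∀ x, φ (x - v) + ∑ i, a i * g i x = 0 := by
  classical
  choose f b hf using hg
  -- Only constraints active at `v` matter: a direction along which none of them decreases stays
  -- feasible for a short time, because inactive constraints have room, so `φ` cannot increase along
  -- it.
  obtain ⟨a, ha, hfa⟩ := exists_nonneg_combination_of_forall_nonneg
    (univ.filter fun i => g i v = 0) f (-φ) (by
      intro d hd
      obtain ⟨t, ht0, ht⟩ : ∃ t : ℝ, 0 < t ∧ ∀ i, 0 ≤ g i (v + t • d) := by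
        have key : ∀ i, ∀ᶠ t in nhdsWithin (0 : ℝ) (Set.Ioi 0), 0 ≤ g i (v + t • d) := by
          intro i
          have e : ∀ t : ℝ, g i (v + t • d) = g i v + t * f i d := fun t => by
            rw [hf, hf, map_add, map_smul, smul_eq_mul]; ring
          simp only [e]
          by_cases hi : g i v = 0
          · filter_upwards [self_mem_nhdsWithin] with t ht
            rw [hi, zero_add]
            exact mul_nonneg (le_of_lt ht) (hd i (by simp [hi]))
          · have hpos : 0 < g i v := lt_of_le_of_ne (hv i) (Ne.symm hi)
            have hc : Filter.Tendsto (fun t : ℝ => g i v + t * f i d) (nhds 0) (nhds (g i v)) := by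
              have : Continuous (fun t : ℝ => g i v + t * f i d) := by fun_prop
              simpa using this.tendsto 0
            exact ((hc.eventually (lt_mem_nhds hpos)).filter_mono nhdsWithin_le_nhds).mono
              fun t ht => ht.le
        obtain ⟨t, h1, h2⟩ := ((Filter.eventually_all.2 key).and self_mem_nhdsWithin).exists
        exact ⟨t, h2, h1⟩
      have h1 := hmax _ ht
      rw [map_add, map_smul, smul_eq_mul] at h1
      rw [LinearMap.neg_apply]
      nlinarith)
  refine ⟨fun i => if g i v = 0 then a i else 0, fun i => ?_, fun i => ?_, fun x => ?_⟩
  · dsimp only; split_ifs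
    exacts [ha i, le_rfl]
  · dsimp only; split_ifs with hi
    · rw [hi, mul_zero]
    · rw [zero_mul]
  · have h1 := hfa (x - v)
    rw [LinearMap.neg_apply] at h1
    have h2 : ∑ i, (if g i v = 0 then a i else 0) * g i x
        = ∑ i ∈ univ.filter (fun i => g i v = 0), a i * f i (x - v) := by
      rw [sum_filter]
      refine sum_congr rfl fun i _ => ?_
      split_ifs with hi
      · have : f i (x - v) = g i x - g i v := by rw [hf, hf, map_sub]; ring
        rw [this, hi, sub_zero]
      · rw [zero_mul]
    rw [h2]; linarith

/-- A linear functional that is bounded above on a nonempty polyhedron attains its maximum. -/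
theorem exists_isMax_of_linear {V ι : Type*} [AddCommGroup V] [Module ℝ V] [Fintype ι]
    {g : ι → V → ℝ} (hg : ∀ i, IsAffineFun (g i)) (φ : V →ₗ[ℝ] ℝ) {M : ℝ}
    (hne : ∃ v, ∀ i, 0 ≤ g i v) (hM : ∀ x, (∀ i, 0 ≤ g i x) → φ x ≤ M) :
    ∃ v, (∀ i, 0 ≤ g i v) ∧ ∀ x, (∀ i, 0 ≤ g i x) → φ x ≤ φ v := by
  classical
  obtain ⟨v, hv⟩ := hne
  set A : Set ℝ := φ '' {x | ∀ i, 0 ≤ g i x} with hA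
  have hAne : A.Nonempty := ⟨φ v, v, hv, rfl⟩
  have hAb : BddAbove A := ⟨M, by rintro _ ⟨x, hx, rfl⟩; exact hM x hx⟩
  have hle : ∀ x, (∀ i, 0 ≤ g i x) → φ x ≤ sSup A := fun x hx => le_csSup hAb ⟨x, hx, rfl⟩
  by_cases hex : ∃ x, (∀ i, 0 ≤ g i x) ∧ sSup A ≤ φ x
  · obtain ⟨x, hx, hx'⟩ := hex
    exact ⟨x, hx, fun y hy => (hle y hy).trans hx'⟩
  exfalso
  push Not at hex
  choose f b hf using hg
  -- Homogenization by an extra coordinate `t`. A point of the cone with `t > 0` would, after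
  -- division by `t`, be feasible and attain the supremum; so non-attainment says that the cone lies
  -- in `t ≤ 0`, to which Farkas' lemma applies.
  let F : Option ι → (V × ℝ) →ₗ[ℝ] ℝ := fun o => o.elim
    (φ ∘ₗ LinearMap.fst ℝ V ℝ - sSup A • LinearMap.snd ℝ V ℝ)
    (fun i => f i ∘ₗ LinearMap.fst ℝ V ℝ + b i • LinearMap.snd ℝ V ℝ)
  obtain ⟨a, ha, hFa⟩ := exists_nonneg_combination_of_forall_nonneg univ F
    (-LinearMap.snd ℝ V ℝ) (by
      rintro ⟨x, t⟩ hx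
      by_contra ht
      replace ht : 0 < t := by simpa using ht
      refine absurd (hex (t⁻¹ • x) fun i => ?_) (not_lt.2 ?_)
      · have := hx (some i) (mem_univ _)
        simp only [F, Option.elim_some, LinearMap.add_apply, LinearMap.comp_apply,
          LinearMap.fst_apply, LinearMap.smul_apply, LinearMap.snd_apply, smul_eq_mul] at this
        have h2 : g i (t⁻¹ • x) = t⁻¹ * (f i x + b i * t) := by
          rw [hf, map_smul, smul_eq_mul]; field_simp
        rw [h2]
        positivity
      · have := hx none (mem_univ _)
        simp only [F, Option.elim_none, LinearMap.sub_apply, LinearMap.comp_apply,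
          LinearMap.fst_apply, LinearMap.smul_apply, LinearMap.snd_apply, smul_eq_mul] at this
        rw [map_smul, smul_eq_mul, inv_mul_eq_div, le_div_iff₀ ht]
        linarith)
  -- The Farkas identity at `t = 1` keeps `φ` a uniform positive distance below its supremum, which
  -- is absurd.
  have key : ∀ x, (∀ i, 0 ≤ g i x) → 1 ≤ a none * (sSup A - φ x) := by
    intro x hx
    have h1 := hFa (x, 1)
    simp only [F, Fintype.sum_option, Option.elim_some, Option.elim_none, LinearMap.add_apply,
      LinearMap.sub_apply, LinearMap.neg_apply, LinearMap.comp_apply, LinearMap.fst_apply,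
      LinearMap.smul_apply, LinearMap.snd_apply, smul_eq_mul, mul_one, ← hf] at h1
    have h2 : 0 ≤ ∑ i, a (some i) * g i x := sum_nonneg fun i _ => mul_nonneg (ha _) (hx i)
    linarith
  have ha0 : 0 < a none := by
    refine lt_of_le_of_ne (ha none) fun h => ?_
    have := key v hv
    rw [← h, zero_mul] at this
    linarith
  have hsup : sSup A ≤ sSup A - (a none)⁻¹ := by
    refine csSup_le hAne ?_
    rintro _ ⟨x, hx, rfl⟩
    have := key x hx
    have h2 : (a none)⁻¹ ≤ sSup A - φ x := by
      rw [inv_le_iff_one_le_mul₀ ha0]; linarith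
    linarith
  have := inv_pos.2 ha0
  linarith

theorem IsAffineFun.exists_hasFDerivWithinAt {V : Type*} [NormedAddCommGroup V] [NormedSpace ℝ V]
    [FiniteDimensional ℝ V] {g : V → ℝ} (hg : IsAffineFun g) :
    ∃ g' : V →L[ℝ] ℝ, (∀ x y, g' (x - y) = g x - g y) ∧ ∀ D v, HasFDerivWithinAt g g' D v := by
  obtain ⟨f, b, hf⟩ := hg
  refine ⟨f.toContinuousLinearMap, fun x y => ?_, fun D v => ?_⟩
  · rw [hf, hf, LinearMap.coe_toContinuousLinearMap', map_sub]
    ring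
  · have : g = fun x => f.toContinuousLinearMap x + b := funext hf
    rw [this]
    exact (f.toContinuousLinearMap.hasFDerivWithinAt).add_const b

theorem IsAffineFun.continuous {V : Type*} [NormedAddCommGroup V] [NormedSpace ℝ V]
    [FiniteDimensional ℝ V] {g : V → ℝ} (hg : IsAffineFun g) : Continuous g := by
  obtain ⟨g', -, h⟩ := hg.exists_hasFDerivWithinAt
  exact continuous_iff_continuousAt.2 fun v => (hasFDerivWithinAt_univ.1 (h _ v)).continuousAt

/-- `F` has a derivative at `v` within `D` that dominates the increments of `F` on `D`. -/
def HasSupergradientWithin {V : Type*} [NormedAddCommGroup V] [NormedSpace ℝ V] (F : V → ℝ)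
    (D : Set V) (v : V) : Prop :=
  ∃ F' : V →L[ℝ] ℝ, HasFDerivWithinAt F F' D v ∧ ∀ x ∈ D, F x ≤ F v + F' (x - v)

namespace HasSupergradientWithin

variable {V : Type*} [NormedAddCommGroup V] [NormedSpace ℝ V] {F H : V → ℝ} {D : Set V} {v : V}

theorem add (hF : HasSupergradientWithin F D v) (hH : HasSupergradientWithin H D v) :
    HasSupergradientWithin (fun x => F x + H x) D v := by
  obtain ⟨F', hF, hF'⟩ := hF
  obtain ⟨H', hH, hH'⟩ := hH
  refine ⟨F' + H', hF.fun_add hH, fun x hx => ?_⟩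
  have h1 := hF' x hx
  have h2 := hH' x hx
  rw [add_apply]
  linarith

theorem of_isAffineFun [FiniteDimensional ℝ V] (hF : IsAffineFun F) :
    HasSupergradientWithin F D v := by
  obtain ⟨F', h, h'⟩ := hF.exists_hasFDerivWithinAt
  exact ⟨F', h' D v, fun x _ => by rw [h]; linarith⟩

theorem sum [FiniteDimensional ℝ V] {ι : Type*} {s : Finset ι} {F : ι → V → ℝ}
    (hF : ∀ i, HasSupergradientWithin (F i) D v) :
    HasSupergradientWithin (fun x => ∑ i ∈ s, F i x) D v := by
  classical
  induction s using Finset.induction_on with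
  | empty => simpa using of_isAffineFun (IsAffineFun.const 0)
  | insert k s hk ih => simpa only [sum_insert hk] using (hF k).add ih

/-- A concave function of one variable lies below its tangents, by comparison of secant slopes with
the derivative. The derivative is taken within `I` because `g v` may be an endpoint: the revenue
functions are only given on `[0, ∞)`, and a server may carry no load. -/
theorem comp_isAffineFun [FiniteDimensional ℝ V] {r : ℝ → ℝ} {I : Set ℝ} {g : V → ℝ}
    (hr : ConcaveOn ℝ I r) (hd : DifferentiableOn ℝ r I) (hg : IsAffineFun g)
    (hgD : Set.MapsTo g D I) (hv : v ∈ D) : HasSupergradientWithin (fun x => r (g x)) D v := by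
  obtain ⟨g', e, hg'⟩ := hg.exists_hasFDerivWithinAt
  have hr' := (hd (g v) (hgD hv)).hasDerivWithinAt
  refine ⟨_, hr'.comp_hasFDerivWithinAt v (hg' D v) hgD, fun x hx => ?_⟩
  rw [smul_apply, e, smul_eq_mul]
  rcases lt_trichotomy (g v) (g x) with h | h | h
  · have := hr.slope_le_derivWithin (hgD hv) (hgD hx) h (hd _ (hgD hv))
    rw [slope_def_field, div_le_iff₀ (by linarith)] at this
    linarith
  · simp [h]
  · have := hr.derivWithin_le_slope (hgD hx) (hgD hv) h (hd _ (hgD hv))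
    rw [slope_def_field, le_div_iff₀ (by linarith)] at this
    linarith

end HasSupergradientWithin

/-- **KKT theorem** for the maximization of a concave differentiable function over a polyhedron:
no constraint qualification is needed. The constraints `d` stay in the domain of the Lagrangian. -/
theorem exists_lagrange_multipliers {V ι κ : Type*} [NormedAddCommGroup V] [NormedSpace ℝ V]
    [Fintype ι] [Fintype κ] {F : V → ℝ} {g : ι → V → ℝ} {d : κ → V → ℝ} {v : V}
    (hg : ∀ i, IsAffineFun (g i)) (hd : ∀ j, IsAffineFun (d j))
    (hF : HasSupergradientWithin F {x | ∀ j, 0 ≤ d j x} v)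
    (hvd : ∀ j, 0 ≤ d j v) (hvg : ∀ i, 0 ≤ g i v)
    (hmax : ∀ x, (∀ j, 0 ≤ d j x) → (∀ i, 0 ≤ g i x) → F x ≤ F v) :
    ∃ a : ι → ℝ, (∀ i, 0 ≤ a i) ∧ (∀ i, a i * g i v = 0) ∧
      ∀ x, (∀ j, 0 ≤ d j x) → F x + ∑ i, a i * g i x ≤ F v := by
  obtain ⟨F', hF', hle⟩ := hF
  let c : ι ⊕ κ → V → ℝ := Sum.elim g d
  have hc : ∀ k, IsAffineFun (c k) := by rintro (i | j); exacts [hg i, hd j]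
  have hcv : ∀ k, 0 ≤ c k v := by rintro (i | j); exacts [hvg i, hvd j]
  -- By the first-order condition along segments, `v` also maximizes the linearization `F'` over the
  -- polyhedron, so the linear case supplies multipliers.
  obtain ⟨a, ha, hslack, hid⟩ := exists_multipliers_of_linear hc F'.toLinearMap hcv (by
    intro x hx
    have hseg : segment ℝ v x ⊆ {y | ∀ k, 0 ≤ c k y} := by
      rintro _ ⟨s, t, hs, ht, hst, rfl⟩ k
      obtain ⟨f, b, hf⟩ := hc k
      have e : c k (s • v + t • x) = s * c k v + t * c k x := by
        rw [hf, hf, hf, map_add, map_smul, map_smul, smul_eq_mul, smul_eq_mul]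
        linear_combination (-b) * hst
      rw [e]
      exact add_nonneg (mul_nonneg hs (hcv k)) (mul_nonneg ht (hx k))
    have hloc : IsLocalMaxOn F {y | ∀ k, 0 ≤ c k y} v :=
      IsMaxOn.localize fun y hy => hmax y (fun j => hy (Sum.inr j)) (fun i => hy (Sum.inl i))
    have := hloc.hasFDerivWithinAt_nonpos
      (hF'.mono fun y hy j => hy (Sum.inr j)) (sub_mem_posTangentConeAt_of_segment_subset hseg)
    rw [map_sub] at this
    exact sub_nonpos.1 this)
  -- The multipliers of the domain constraints can be dropped because their terms are nonnegative on
  -- the domain; the supergradient inequality then replaces `F'` by `F`.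
  refine ⟨fun i => a (Sum.inl i), fun i => ha _, fun i => hslack (Sum.inl i), fun x hx => ?_⟩
  have h1 := hid x
  rw [Fintype.sum_sum_type] at h1
  have h2 : 0 ≤ ∑ j, a (Sum.inr j) * c (Sum.inr j) x :=
    sum_nonneg fun j _ => mul_nonneg (ha _) (hx j)
  have h3 := hle x hx
  have h4 : F'.toLinearMap (x - v) = F' (x - v) := rfl
  rw [h4] at h1
  have h5 : ∑ i, a (Sum.inl i) * c (Sum.inl i) x = ∑ i, a (Sum.inl i) * g i x := rfl
  linarith

end Polyhedra

/-! ### Solvability of the inner problem and of the feasibility problem. -/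

namespace MEC

open Finset

variable {E S : ℕ}

/-- The vector space of the continuous variables. -/
abbrev SimpVec (E S : ℕ) := (Fin S → Fin E → Server E → ℝ) × (Server E → Fin S → ℝ)

/-- The continuous variables with given coordinates. -/
def SimpVec.toSimp (v : SimpVec E S) : Simp E S := ⟨v.1, v.2⟩

/-- The coordinates of the continuous variables. -/
def Simp.toVec (w : Simp E S) : SimpVec E S := (w.y, w.u)

/-- Indices of the inequalities that define `simpDom`. -/
abbrev DomIdx (E S : ℕ) :=
  (Fin S × Fin E × Server E) ⊕ (Fin S × Fin E × Server E) ⊕ (Server E × Fin S)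

/-- The functions whose nonnegativity defines `simpDom`. -/
def domFun : DomIdx E S → SimpVec E S → ℝ
  | .inl i, v => v.1 i.1 i.2.1 i.2.2
  | .inr (.inl i), v => 1 - v.1 i.1 i.2.1 i.2.2
  | .inr (.inr i), v => v.2 i.1 i.2

theorem toSimp_mem_simpDom {v : SimpVec E S} :
    v.toSimp ∈ simpDom E S ↔ ∀ j, 0 ≤ domFun j v := by
  constructor
  · rintro ⟨h1, h2⟩ (j | j | j)
    · exact (h1 _ _ _).1
    · exact sub_nonneg.2 (h1 _ _ _).2
    · exact h2 _ _
  · intro h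
    exact ⟨fun s e n => ⟨h (.inl (s, e, n)), sub_nonneg.1 (h (.inr (.inl (s, e, n))))⟩,
      fun n s => h (.inr (.inr (n, s)))⟩

theorem mem_simpDom {w : Simp E S} : w ∈ simpDom E S ↔ ∀ j, 0 ≤ domFun j w.toVec :=
  toSimp_mem_simpDom (v := w.toVec)

theorem isAffineFun_y (s : Fin S) (e : Fin E) (n : Server E) :
    IsAffineFun (fun v : SimpVec E S => v.toSimp.y s e n) :=
  .of_linear
    { toFun := fun v : SimpVec E S => v.1 s e n, map_add' := fun _ _ => rfl, map_smul' := fun _ _ => rfl }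

theorem isAffineFun_u (n : Server E) (s : Fin S) :
    IsAffineFun (fun v : SimpVec E S => v.toSimp.u n s) :=
  .of_linear
    { toFun := fun v : SimpVec E S => v.2 n s, map_add' := fun _ _ => rfl, map_smul' := fun _ _ => rfl }

theorem isAffineFun_domFun (j : DomIdx E S) : IsAffineFun (domFun j) := by
  rcases j with j | j | j
  · exact isAffineFun_y _ _ _
  · exact (IsAffineFun.const 1).sub (isAffineFun_y _ _ _)
  · exact isAffineFun_u _ _

theorem bit_nonneg (b : Bool) : 0 ≤ bit b := by cases b <;> simp [bit]

theorem bit_le_one (b : Bool) : bit b ≤ 1 := by cases b <;> simp [bit]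

namespace Params

variable (P : Params E S)

theorem isAffineFun_Lam (n : Server E) (s : Fin S) :
    IsAffineFun (fun v : SimpVec E S => P.Lam v.toSimp n s) :=
  .sum fun _ => (isAffineFun_y _ _ _).const_mul _

theorem isAffineFun_LamL (e : Fin E) (n : Server E) :
    IsAffineFun (fun v : SimpVec E S => P.LamL v.toSimp e n) :=
  .sum fun _ => (isAffineFun_y _ _ _).const_mul _

theorem isAffineFun_G (c : Compl E S) (i : Con E S) :
    IsAffineFun (fun v : SimpVec E S => P.G c v.toSimp i) := by
  have slack : ∀ n s, IsAffineFun
      (fun v : SimpVec E S => v.toSimp.u n s / P.nu s - P.Lam v.toSimp n s) :=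
    fun n s => ((isAffineFun_u n s).div_const _).sub (P.isAffineFun_Lam n s)
  cases i with
  | admission s e => exact (IsAffineFun.const _).sub (.sum fun _ => isAffineFun_y _ _ _)
  | bandwidth e =>
    exact (IsAffineFun.const _).sub
      (.sum fun _ => (IsAffineFun.sum fun _ => (isAffineFun_y _ _ _).const_mul _).const_mul _)
  | cpu e => exact (IsAffineFun.const _).sub (.sum fun _ => isAffineFun_u _ _)
  | nodeStability n s => exact slack n s
  | linkStability p => exact (IsAffineFun.const _).sub (P.isAffineFun_LamL _ _)
  | localDelay s e => exact ((slack _ s).const_mul _).sub (.const _)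
  | remoteDelay s p => exact ((slack _ s).const_mul _).sub (.const _)
  | networkDelay s p =>
    exact (((IsAffineFun.const _).sub (P.isAffineFun_LamL _ _)).const_mul _).sub (.const _)
  | transfer s e n => exact (IsAffineFun.const _).sub (isAffineFun_y _ _ _)

theorem Lam_nonneg {w : Simp E S} (hw : w ∈ simpDom E S) (n : Server E) (s : Fin S) :
    0 ≤ P.Lam w n s :=
  sum_nonneg fun e _ => mul_nonneg (P.lam_nonneg e s) (hw.1 s e n).1

theorem Lam_le {w : Simp E S} (hw : w ∈ simpDom E S) (n : Server E) (s : Fin S) :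
    P.Lam w n s ≤ ∑ e, P.lam e s :=
  sum_le_sum fun e _ => mul_le_of_le_one_right (P.lam_nonneg e s) (hw.1 s e n).2

theorem hasSupergradientWithin_innerObj {v : SimpVec E S} (hv : v.toSimp ∈ simpDom E S) :
    HasSupergradientWithin (fun v : SimpVec E S => P.innerObj v.toSimp)
      {v | v.toSimp ∈ simpDom E S} v := by
  have hcost : IsAffineFun
      (fun v : SimpVec E S => -P.cpuCost v.toSimp + -P.trnCost v.toSimp) := by
    refine .add (.neg ?_) (.neg ?_)
    · exact .sum fun _ => .sum fun _ => (isAffineFun_u _ _).const_mul _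
    · exact .sum fun _ => .sum fun _ => (P.isAffineFun_LamL _ _).mul_const _
  have hrev : HasSupergradientWithin (fun v : SimpVec E S => P.revenue v.toSimp)
      {v | v.toSimp ∈ simpDom E S} v :=
    .sum fun s => .sum fun n => .comp_isAffineFun (P.R_concave n s)
      ((P.R_contDiff n s).differentiableOn (by norm_num)) (P.isAffineFun_Lam n s)
      (fun _ hx => P.Lam_nonneg hx n s) hv
  have := hrev.add (.of_isAffineFun hcost)
  simpa only [innerObj, sub_eq_add_neg, add_assoc] using this

/-- A bound on the CPU frequencies that can be imposed without loss of optimality. -/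
noncomputable def uCap (s : Fin S) : ℝ :=
  P.nu s * (∑ e, P.lam e s + ((P.Dmax s)⁻¹ + ((1 - P.alpha) * P.Dmax s)⁻¹))

theorem coeff_nonneg (s : Fin S) : 0 ≤ (1 - P.alpha) * P.Dmax s :=
  mul_nonneg (sub_nonneg.2 P.alpha_mem.2) (P.Dmax_nonneg s)

theorem uCap_nonneg (s : Fin S) : 0 ≤ P.uCap s :=
  mul_nonneg (P.nu_pos s).le (add_nonneg (sum_nonneg fun e _ => P.lam_nonneg e s)
    (add_nonneg (inv_nonneg.2 (P.Dmax_nonneg s)) (inv_nonneg.2 (P.coeff_nonneg s))))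

/-- Capping the CPU frequencies. -/
noncomputable def capped (w : Simp E S) : Simp E S := ⟨w.y, fun n s => min (w.u n s) (P.uCap s)⟩

/-- If the cap is active, the slack `u / ν - Λ` is still at least `k⁻¹`: the cap reserves the
largest possible load plus the inverses of both delay coefficients. Then `k` times the slack is at
least `1`, which dominates any binary `z`. -/
theorem le_slack_capped {w : Simp E S} (hw : w ∈ simpDom E S) (n : Server E) (s : Fin S)
    {k z : ℝ} (hk : k = P.Dmax s ∨ k = (1 - P.alpha) * P.Dmax s) (hz : z ≤ 1)
    (h : z ≤ k * (w.u n s / P.nu s - P.Lam w n s)) :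
    z ≤ k * ((P.capped w).u n s / P.nu s - P.Lam (P.capped w) n s) := by
  have hLam : P.Lam (P.capped w) n s = P.Lam w n s := rfl
  have hu : (P.capped w).u n s = min (w.u n s) (P.uCap s) := rfl
  rw [hLam, hu]
  rcases min_choice (w.u n s) (P.uCap s) with e | e
  · rwa [e]
  rw [e, uCap, mul_div_cancel_left₀ _ (P.nu_pos s).ne']
  have hk0 : 0 ≤ k := by
    rcases hk with rfl | rfl
    exacts [P.Dmax_nonneg s, P.coeff_nonneg s]
  -- For `k = 0` the delay inequality does not involve `u` at all; the convention `0⁻¹ = 0` then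
  -- adds nothing to the cap.
  rcases hk0.eq_or_lt with h0 | h0
  · rw [← h0, zero_mul] at h ⊢
    exact h
  have h1 : k⁻¹ ≤ (P.Dmax s)⁻¹ + ((1 - P.alpha) * P.Dmax s)⁻¹ := by
    rcases hk with rfl | rfl
    · exact le_add_of_nonneg_right (inv_nonneg.2 (P.coeff_nonneg s))
    · exact le_add_of_nonneg_left (inv_nonneg.2 (P.Dmax_nonneg s))
  have h2 := P.Lam_le hw n s
  calc z ≤ k * k⁻¹ := by rwa [mul_inv_cancel₀ h0.ne']
    _ ≤ _ := by gcongr; linarith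

theorem capped_mem_innerSet {c : Compl E S} {w : Simp E S} (hw : w ∈ P.innerSet c) :
    P.capped w ∈ P.innerSet c := by
  obtain ⟨hd, hG⟩ := hw
  refine ⟨⟨hd.1, fun n s => le_min (hd.2 n s) (P.uCap_nonneg s)⟩, fun i => ?_⟩
  have hi := hG i
  cases i with
  | admission s e => exact hi
  | bandwidth e => exact hi
  | cpu e =>
    refine hi.trans (sub_le_sub_left (sum_le_sum fun s _ => ?_) _)
    exact min_le_left _ _
  | nodeStability n s =>
    have hLam : P.Lam (P.capped w) n s = P.Lam w n s := rfl
    have hu : (P.capped w).u n s = min (w.u n s) (P.uCap s) := rfl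
    simp only [G] at hi ⊢
    rw [hLam, hu]
    rcases min_choice (w.u n s) (P.uCap s) with e | e
    · rwa [e]
    · rw [e, uCap, mul_div_cancel_left₀ _ (P.nu_pos s).ne']
      have h1 := P.Lam_le hd n s
      have h2 := inv_nonneg.2 (P.Dmax_nonneg s)
      have h3 := inv_nonneg.2 (P.coeff_nonneg s)
      linarith
  | linkStability p => exact hi
  | localDelay s e =>
    exact sub_nonneg.2 (P.le_slack_capped hd _ s (.inl rfl) (bit_le_one _) (sub_nonneg.1 hi))
  | remoteDelay s p =>
    exact sub_nonneg.2 (P.le_slack_capped hd _ s (.inr rfl) (bit_le_one _) (sub_nonneg.1 hi))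
  | networkDelay s p => exact hi
  | transfer s e n => exact hi

theorem innerObj_le_capped (w : Simp E S) : P.innerObj w ≤ P.innerObj (P.capped w) := by
  have h1 : P.cpuCost (P.capped w) ≤ P.cpuCost w :=
    sum_le_sum fun s _ => sum_le_sum fun n _ =>
      mul_le_mul_of_nonneg_left (min_le_left _ _) (P.pcpu_nonneg n)
  have h2 : P.revenue (P.capped w) = P.revenue w := rfl
  have h3 : P.trnCost (P.capped w) = P.trnCost w := rfl
  rw [innerObj, innerObj, h2, h3]
  linarith

/-- A feasible inner problem has an optimal solution. -/
theorem exists_isMaxOn_innerObj {c : Compl E S} (hne : (P.innerSet c).Nonempty) :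
    ∃ w ∈ P.innerSet c, IsMaxOn P.innerObj (P.innerSet c) w := by
  let box : Set (SimpVec E S) :=
    Set.Icc (fun _ _ _ => 0, fun _ _ => 0) (fun _ _ _ => 1, fun _ s => P.uCap s)
  -- The CPU variables of the cloud have no capacity constraint, so the inner feasible set need not
  -- be compact. Capping stays feasible and does not lower the objective, so a maximizer over the
  -- compact set `K` is a maximizer over the whole set.
  let K : Set (SimpVec E S) := box ∩ {v | ∀ i, 0 ≤ P.G c v.toSimp i}
  have hKc : IsCompact K := by
    refine isCompact_Icc.inter_right ?_
    rw [Set.ofPred_forall]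
    exact isClosed_iInter fun i => isClosed_le continuous_const (P.isAffineFun_G c i).continuous
  have hKd : K ⊆ {v | v.toSimp ∈ simpDom E S} := fun v hv =>
    ⟨fun s e n => ⟨hv.1.1.1 s e n, hv.1.2.1 s e n⟩, fun n s => hv.1.1.2 n s⟩
  have hcap : ∀ w ∈ P.innerSet c, (P.capped w).toVec ∈ K := by
    intro w hw
    have h := P.capped_mem_innerSet hw
    refine ⟨⟨⟨?_, ?_⟩, ⟨?_, ?_⟩⟩, h.2⟩
    · exact fun s e n => (h.1.1 s e n).1
    · exact fun n s => h.1.2 n s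
    · exact fun s e n => (h.1.1 s e n).2
    · exact fun n s => min_le_right _ _
  obtain ⟨w₀, hw₀⟩ := hne
  have hcont : ContinuousOn (fun v : SimpVec E S => P.innerObj v.toSimp) K := fun v hv => by
    obtain ⟨F', hF', -⟩ := P.hasSupergradientWithin_innerObj (hKd hv)
    exact hF'.continuousWithinAt.mono hKd
  obtain ⟨v, hv, hmax⟩ := hKc.exists_isMaxOn ⟨_, hcap w₀ hw₀⟩ hcont
  refine ⟨v.toSimp, ⟨hKd hv, hv.2⟩, isMaxOn_iff.2 fun w hw => ?_⟩
  exact (P.innerObj_le_capped w).trans (isMaxOn_iff.1 hmax (P.capped w).toVec (hcap w hw))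

theorem simpDom_eq :
    {v : SimpVec E S | v.toSimp ∈ simpDom E S} = {v | ∀ j, 0 ≤ domFun j v} :=
  Set.ext fun _ => toSimp_mem_simpDom

/-- A feasible inner problem is solvable, with Lagrange multipliers. -/
theorem exists_innerSolved {c : Compl E S} (hne : (P.innerSet c).Nonempty) :
    ∃ w mu, P.InnerSolved c w mu := by
  obtain ⟨w, hw, hmax⟩ := P.exists_isMaxOn_innerObj hne
  have hd := P.hasSupergradientWithin_innerObj (v := w.toVec) hw.1
  rw [simpDom_eq] at hd
  obtain ⟨mu, hmu, hslack, hlag⟩ := exists_lagrange_multipliers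
    (F := fun v : SimpVec E S => P.innerObj v.toSimp) (v := w.toVec)
    (P.isAffineFun_G c) isAffineFun_domFun hd (mem_simpDom.1 hw.1) hw.2
    (fun x hx hx' => hmax ⟨toSimp_mem_simpDom.2 hx, hx'⟩)
  refine ⟨w, mu, hw, hmax, hmu, fun w' hw' => ?_, hslack⟩
  have h := hlag w'.toVec (mem_simpDom.1 hw')
  have h0 : ∑ i, mu i * P.G c w i = 0 := sum_eq_zero fun i _ => hslack i
  change P.innerObj w' + ∑ i, mu i * P.G c w' i ≤ P.innerObj w + ∑ i, mu i * P.G c w i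
  rw [h0, add_zero]
  exact h

theorem zero_mem_simpDom : (⟨fun _ _ _ => 0, fun _ _ => 0⟩ : Simp E S) ∈ simpDom E S :=
  ⟨fun _ _ _ => ⟨le_rfl, zero_le_one⟩, fun _ _ => le_rfl⟩

/-- The feasibility problem of an infeasible inner problem is solvable, with Lagrange
multipliers. -/
theorem exists_feasSolved {c : Compl E S} (hne : P.innerSet c = ∅) :
    ∃ g w lm, P.FeasSolved c g w lm := by
  let con : Con E S → ℝ × SimpVec E S → ℝ := fun i q => P.G c q.2.toSimp i + q.1
  let dom : DomIdx E S → ℝ × SimpVec E S → ℝ := fun j q => domFun j q.2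
  let φ : ℝ × SimpVec E S →ₗ[ℝ] ℝ := -LinearMap.fst ℝ ℝ (SimpVec E S)
  have hφ : ∀ q, φ q = -q.1 := fun _ => rfl
  have hcon : ∀ i, IsAffineFun (con i) := fun i =>
    ((P.isAffineFun_G c i).comp_linear (LinearMap.snd ℝ ℝ _)).add
      (IsAffineFun.of_linear (LinearMap.fst ℝ ℝ (SimpVec E S)))
  have hdom : ∀ j, IsAffineFun (dom j) := fun j =>
    (isAffineFun_domFun j).comp_linear (LinearMap.snd ℝ ℝ _)
  -- A value `γ ≤ 0` would make the inner problem feasible. So `-γ` is bounded above by `0`, and the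
  -- linear program has an optimum although its feasible set is unbounded.
  have hpos : ∀ q : ℝ × SimpVec E S, (∀ j, 0 ≤ dom j q) → (∀ i, 0 ≤ con i q) → 0 < q.1 := by
    intro q hq hq'
    by_contra hneg
    have : q.2.toSimp ∈ P.innerSet c :=
      ⟨toSimp_mem_simpDom.2 hq, fun i => by
        have : 0 ≤ P.G c q.2.toSimp i + q.1 := hq' i
        linarith⟩
    rw [hne] at this
    exact this
  obtain ⟨q, hq, hmax⟩ := exists_isMax_of_linear (g := Sum.elim con dom)
    (by rintro (i | j); exacts [hcon i, hdom j]) φ (M := 0)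
    (by
      set w : Simp E S := ⟨fun _ _ _ => 0, fun _ _ => 0⟩
      refine ⟨(∑ i, |P.G c w i|, w.toVec), ?_⟩
      rintro (i | j)
      · have h1 : |P.G c w i| ≤ ∑ i, |P.G c w i| :=
          single_le_sum (f := fun i => |P.G c w i|) (fun i _ => abs_nonneg _) (mem_univ i)
        have h2 := neg_abs_le (P.G c w i)
        change 0 ≤ P.G c w i + ∑ i, |P.G c w i|
        linarith
      · exact mem_simpDom.1 zero_mem_simpDom j)
    (by
      intro q hq
      have := hpos q (fun j => hq (.inr j)) fun i => hq (.inl i)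
      rw [hφ]
      linarith)
  obtain ⟨lm, hlm, hslack, hlag⟩ := exists_lagrange_multipliers (F := φ) (v := q) hcon hdom
    (.of_isAffineFun (.of_linear φ)) (fun j => hq (.inr j)) (fun i => hq (.inl i))
    (fun x hx hx' => hmax x (by rintro (i | j); exacts [hx' i, hx j]))
  refine ⟨q.1, q.2.toSimp, lm,
    ⟨toSimp_mem_simpDom.2 fun j => hq (.inr j), fun i => hq (.inl i)⟩, ?_, hlm, ?_, hslack⟩
  · rintro ⟨g, w⟩ ⟨hw, hG⟩
    have := hmax (g, w.toVec) (by
      rintro (i | j)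
      exacts [hG i, mem_simpDom.1 hw j])
    rw [hφ, hφ] at this
    exact neg_le_neg_iff.1 this
  · rintro ⟨g, w⟩ ⟨-, hw⟩
    have h := hlag (g, w.toVec) (mem_simpDom.1 hw)
    have h0 : ∑ i, lm i * (P.G c q.2.toSimp i + q.1) = 0 := sum_eq_zero fun i _ => hslack i
    change q.1 - ∑ i, lm i * (P.G c q.2.toSimp i + q.1)
      ≤ g - ∑ i, lm i * (P.G c w i + g)
    have h' : -g + ∑ i, lm i * (P.G c w i + g) ≤ -q.1 := h
    rw [h0]
    linarith

end Params

end MEC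

/-! ### Validity and tightness of the cuts, and the relaxed master problem. -/

namespace MEC

open Finset

variable {E S : ℕ}

instance : Finite (Compl E S) :=
  Finite.of_injective (fun c : Compl E S => (c.x, c.z)) fun c c' h => by
    cases c; cases c'; simpa using h

/-- The constraints, arranged in a sum of products. -/
def conEquiv : Con E S ≃ (Fin S × Fin E) ⊕ Fin E ⊕ Fin E ⊕ (Server E × Fin S) ⊕ OffLink E ⊕
    (Fin S × Fin E) ⊕ (Fin S × OffLink E) ⊕ (Fin S × OffLink E) ⊕
    (Fin S × Fin E × Server E) where
  toFun
    | .admission s e => .inl (s, e)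
    | .bandwidth e => .inr (.inl e)
    | .cpu e => .inr (.inr (.inl e))
    | .nodeStability n s => .inr (.inr (.inr (.inl (n, s))))
    | .linkStability p => .inr (.inr (.inr (.inr (.inl p))))
    | .localDelay s e => .inr (.inr (.inr (.inr (.inr (.inl (s, e))))))
    | .remoteDelay s p => .inr (.inr (.inr (.inr (.inr (.inr (.inl (s, p)))))))
    | .networkDelay s p => .inr (.inr (.inr (.inr (.inr (.inr (.inr (.inl (s, p))))))))
    | .transfer s e n => .inr (.inr (.inr (.inr (.inr (.inr (.inr (.inr (s, e, n))))))))
  invFun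
    | .inl (s, e) => .admission s e
    | .inr (.inl e) => .bandwidth e
    | .inr (.inr (.inl e)) => .cpu e
    | .inr (.inr (.inr (.inl (n, s)))) => .nodeStability n s
    | .inr (.inr (.inr (.inr (.inl p)))) => .linkStability p
    | .inr (.inr (.inr (.inr (.inr (.inl (s, e)))))) => .localDelay s e
    | .inr (.inr (.inr (.inr (.inr (.inr (.inl (s, p))))))) => .remoteDelay s p
    | .inr (.inr (.inr (.inr (.inr (.inr (.inr (.inl (s, p)))))))) => .networkDelay s p
    | .inr (.inr (.inr (.inr (.inr (.inr (.inr (.inr (s, e, n)))))))) => .transfer s e n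
  left_inv i := by cases i <;> rfl
  right_inv i := by rcases i with i | i | i | i | i | i | i | i | i <;> rfl

theorem sum_con (f : Con E S → ℝ) :
    ∑ i, f i = ∑ s, ∑ e, f (.admission s e) + ∑ e, f (.bandwidth e) + ∑ e, f (.cpu e)
      + ∑ n, ∑ s, f (.nodeStability n s) + ∑ p, f (.linkStability p)
      + ∑ s, ∑ e, f (.localDelay s e) + ∑ s, ∑ p, f (.remoteDelay s p)
      + ∑ s, ∑ p, f (.networkDelay s p) + ∑ s, ∑ e, ∑ n, f (.transfer s e n) := by
  rw [← conEquiv.symm.sum_comp]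
  simp only [Fintype.sum_sum_type, Fintype.sum_prod_type, add_assoc]
  rfl

namespace Params

variable {P : Params E S}

/-- The constraint functions are separable in the complicating and the simple variables. -/
theorem G_separable (c c' : Compl E S) (w w' : Simp E S) (i : Con E S) :
    P.G c w' i - P.G c w i = P.G c' w' i - P.G c' w i := by
  cases i <;> simp only [G] <;> ring

theorem sum_G_separable (a : Con E S → ℝ) (c c' : Compl E S) (w w' : Simp E S) :
    ∑ i, a i * P.G c w' i - ∑ i, a i * P.G c w i
      = ∑ i, a i * P.G c' w' i - ∑ i, a i * P.G c' w i := by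
  simp only [← sum_sub_distrib, ← mul_sub]
  exact sum_congr rfl fun i _ => by rw [G_separable c c']

/-- The explicit cut omits the constraints that do not involve the complicating variables. Their
terms have the same value at `c'` as at `c`, where complementary slackness makes them zero. -/
theorem InnerSolved.LUpper_eq {c : Compl E S} {w : Simp E S} {mu : Con E S → ℝ}
    (h : P.InnerSolved c w mu) (c' : Compl E S) :
    P.LUpper w mu c' = P.innerObj w - P.strCost c' + ∑ i, mu i * P.G c' w i := by
  rw [sum_con, LUpper]
  have h1 : ∀ s e, mu (.admission s e) * P.G c' w (.admission s e) = 0 :=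
    fun s e => h.slackness (.admission s e)
  have h2 : ∀ e, mu (.bandwidth e) * P.G c' w (.bandwidth e) = 0 :=
    fun e => h.slackness (.bandwidth e)
  have h3 : ∀ e, mu (.cpu e) * P.G c' w (.cpu e) = 0 := fun e => h.slackness (.cpu e)
  have h4 : ∀ n s, mu (.nodeStability n s) * P.G c' w (.nodeStability n s) = 0 :=
    fun n s => h.slackness (.nodeStability n s)
  have h5 : ∀ p, mu (.linkStability p) * P.G c' w (.linkStability p) = 0 :=
    fun p => h.slackness (.linkStability p)
  simp only [h1, h2, h3, h4, h5, sum_const_zero]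
  ring

/-- The optimality cut is tight where it was generated. -/
theorem InnerSolved.LUpper_self {c : Compl E S} {w : Simp E S} {mu : Con E S → ℝ}
    (h : P.InnerSolved c w mu) : P.LUpper w mu c = P.innerObj w - P.strCost c := by
  rw [h.LUpper_eq, sum_eq_zero fun i _ => h.slackness i, add_zero]

/-- Optimality cuts bound the profit. -/
theorem InnerSolved.profit_le {c : Compl E S} {w : Simp E S} {mu : Con E S → ℝ}
    (h : P.InnerSolved c w mu) {c' : Compl E S} {w' : Simp E S} (hw' : w' ∈ P.innerSet c') :
    P.profit c' w' ≤ P.LUpper w mu c' := by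
  have h1 : P.innerObj w' + ∑ i, mu i * P.G c w' i ≤ P.innerObj w + ∑ i, mu i * P.G c w i :=
    h.lagrangian hw'.1
  -- Separability carries the maximality of `w` for the Lagrangian from `c` over to `c'`.
  have h2 := sum_G_separable (P := P) mu c c' w w'
  have h3 : 0 ≤ ∑ i, mu i * P.G c' w' i :=
    sum_nonneg fun i _ => mul_nonneg (h.nonneg i) (hw'.2 i)
  rw [h.LUpper_eq, profit]
  linarith

/-- The Lagrangian is affine in the free variable `γ` with slope `1 - ∑ i, lm i`, so a minimum
forces the slope to vanish; shifts of `γ` by `1` and `-1` suffice. -/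
theorem FeasSolved.sum_eq_one {c : Compl E S} {g : ℝ} {w : Simp E S} {lm : Con E S → ℝ}
    (h : P.FeasSolved c g w lm) : ∑ i, lm i = 1 := by
  have key : ∀ t : ℝ, t * ∑ i, lm i ≤ t := by
    intro t
    have h1 : g - ∑ i, lm i * (P.G c w i + g) ≤ (g + t) - ∑ i, lm i * (P.G c w i + (g + t)) :=
      h.lagrangian (show (g + t, w) ∈ Set.univ ×ˢ simpDom E S from ⟨trivial, h.mem.1⟩)
    have h2 : ∑ i, lm i * (P.G c w i + (g + t))
        = ∑ i, lm i * (P.G c w i + g) + t * ∑ i, lm i := by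
      rw [mul_sum, ← sum_add_distrib]
      exact sum_congr rfl fun i _ => by ring
    linarith
  linarith [key 1, key (-1)]

/-- Feasibility cuts keep every point whose inner problem is feasible. -/
theorem FeasSolved.LLower_nonneg {c : Compl E S} {g : ℝ} {w : Simp E S} {lm : Con E S → ℝ}
    (h : P.FeasSolved c g w lm) {c' : Compl E S} {w' : Simp E S} (hw' : w' ∈ P.innerSet c') :
    0 ≤ P.LLower w lm c' := by
  have h1 : g - ∑ i, lm i * (P.G c w i + g) ≤ g - ∑ i, lm i * (P.G c w' i + g) :=
    h.lagrangian (show (g, w') ∈ Set.univ ×ˢ simpDom E S from ⟨trivial, hw'.1⟩)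
  simp only [mul_add, sum_add_distrib] at h1
  have h2 := sum_G_separable (P := P) lm c c' w w'
  have h3 : 0 ≤ ∑ i, lm i * P.G c' w' i :=
    sum_nonneg fun i _ => mul_nonneg (h.nonneg i) (hw'.2 i)
  rw [LLower]
  linarith

/-- The feasibility cut removes the point where it was generated. -/
theorem FeasSolved.LLower_self {c : Compl E S} {g : ℝ} {w : Simp E S} {lm : Con E S → ℝ}
    (h : P.FeasSolved c g w lm) (hc : P.innerSet c = ∅) : P.LLower w lm c < 0 := by
  have hg : 0 < g := by
    by_contra hg
    have : w ∈ P.innerSet c := ⟨h.mem.1, fun i => by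
      have : 0 ≤ P.G c w i + g := h.mem.2 i
      linarith⟩
    rw [hc] at this
    exact this
  -- As the multipliers sum to `1`, this says that the cut takes the value `-g` at `c`.
  have h1 : ∑ i, lm i * (P.G c w i + g) = 0 := sum_eq_zero fun i _ => h.slackness i
  simp only [mul_add, sum_add_distrib, ← sum_mul, h.sum_eq_one] at h1
  rw [LLower]
  linarith

theorem InnerSolved.innerVal_eq {c : Compl E S} {w : Simp E S} {mu : Con E S → ℝ}
    (h : P.InnerSolved c w mu) : P.innerVal c = (P.innerObj w : EReal) :=
  le_antisymm (iSup₂_le fun _ hw' => EReal.coe_le_coe_iff.2 (h.isMax hw'))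
    (le_iSup₂ (f := fun w (_ : w ∈ P.innerSet c) => (P.innerObj w : EReal)) w h.mem)

theorem innerVal_eq_bot {c : Compl E S} : P.innerVal c = ⊥ ↔ P.innerSet c = ∅ := by
  simp [innerVal, Set.eq_empty_iff_forall_notMem]

/-- All cuts come from solved subproblems. -/
def CutsValid (P : Params E S) (oc fc : List (CutData E S)) : Prop :=
  (∀ k ∈ oc, ∃ c, P.InnerSolved c k.1 k.2) ∧ ∀ k ∈ fc, ∃ c g, P.FeasSolved c g k.1 k.2

/-- One of the cuts was generated at `c`. -/
def CutAt (P : Params E S) (oc fc : List (CutData E S)) (c : Compl E S) : Prop :=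
  (∃ k ∈ oc, P.InnerSolved c k.1 k.2) ∨
    P.innerVal c = ⊥ ∧ ∃ k ∈ fc, ∃ g, P.FeasSolved c g k.1 k.2

theorem CutsValid.masterFeasible {oc fc : List (CutData E S)} (h : P.CutsValid oc fc)
    {c : Compl E S} {w : Simp E S} (hcw : P.Feasible c w) :
    P.MasterFeasible oc fc (P.profit c w : EReal) c := by
  refine ⟨hcw.1, fun k hk => ?_, fun k hk => ?_⟩
  · obtain ⟨_, hs⟩ := h.1 k hk
    exact EReal.coe_le_coe_iff.2 (hs.profit_le hcw.2)
  · obtain ⟨_, _, hs⟩ := h.2 k hk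
    exact hs.LLower_nonneg hcw.2

/-- Storing every service in the cloud only and serving no request is always feasible. This point
survives all valid cuts, so the master problem never becomes infeasible. -/
theorem exists_feasible (P : Params E S) : ∃ c w, P.Feasible c w := by
  refine ⟨⟨fun n _ => n.isNone, fun _ _ _ => false⟩, ⟨fun _ _ _ => 0, fun _ _ => 0⟩,
    ⟨fun e => ?_, fun s e n => ?_, fun s _ => rfl⟩, zero_mem_simpDom, fun i => ?_⟩
  · simpa [bit] using P.C_nonneg e
  · exact mul_nonneg (bit_nonneg _) (bit_nonneg _)
  · have hL : ∀ n s, P.Lam ⟨fun _ _ _ => 0, fun _ _ => 0⟩ n s = 0 := by simp [Lam]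
    have hL' : ∀ e n, P.LamL ⟨fun _ _ _ => 0, fun _ _ => 0⟩ e n = 0 := by simp [LamL]
    cases i <;> simp only [G, hL, hL'] <;> simp [bit, P.B_nonneg, P.M_nonneg, P.Bl_nonneg]
    exact mul_nonneg (le_max_right _ _) (P.Bl_nonneg _ _)

/-- The relaxed master problem is solvable. -/
theorem CutsValid.exists_masterSolved {oc fc : List (CutData E S)} (h : P.CutsValid oc fc) :
    ∃ ub c, P.MasterSolved oc fc ub c := by
  obtain ⟨c₀, w₀, h₀⟩ := P.exists_feasible
  -- The best `UB` for a fixed binary point, equal to `⊤` when there is no optimality cut; it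
  -- remains to maximize over finitely many points.
  let val : Compl E S → EReal := fun c => ⨅ k ∈ oc, (P.LUpper k.1 k.2 c : EReal)
  obtain ⟨c, ⟨hc, hfc⟩, hmax⟩ := Set.exists_max_image
    {c | P.ComplFeasible c ∧ ∀ k ∈ fc, 0 ≤ P.LLower k.1 k.2 c} val (Set.toFinite _)
    ⟨c₀, h₀.1, (h.masterFeasible h₀).2.2⟩
  exact ⟨val c, c, ⟨hc, fun k hk => iInf₂_le k hk, hfc⟩, fun ub' c' h' =>
    (le_iInf₂ h'.2.1).trans (hmax c' ⟨h'.1, h'.2.2⟩)⟩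

theorem Step.masterSolved {ε : ℝ} {st st' : State E S} (h : P.Step ε st st') :
    P.MasterSolved st'.optCuts st'.feasCuts st'.UB st'.c := by
  cases h <;> assumption

theorem Step.cutsValid {ε : ℝ} {st st' : State E S} (h : P.Step ε st st')
    (hv : P.CutsValid st.optCuts st.feasCuts) : P.CutsValid st'.optCuts st'.feasCuts := by
  cases h with
  | optimality w mu ub c solved feas gap master =>
    exact ⟨List.forall_mem_cons.2 ⟨⟨_, solved⟩, hv.1⟩, hv.2⟩
  | feasibility g w lm ub c infeas solved master =>
    exact ⟨hv.1, List.forall_mem_cons.2 ⟨⟨_, _, solved⟩, hv.2⟩⟩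

theorem Step.cutAt {ε : ℝ} {st st' : State E S} (h : P.Step ε st st') :
    P.CutAt st'.optCuts st'.feasCuts st.c := by
  cases h with
  | optimality w mu ub c solved feas gap master =>
    exact .inl ⟨_, List.mem_cons_self, solved⟩
  | feasibility g w lm ub c infeas solved master =>
    exact .inr ⟨infeas, _, List.mem_cons_self, _, solved⟩

theorem Step.cutAt_of_cutAt {ε : ℝ} {st st' : State E S} (h : P.Step ε st st') {c₀ : Compl E S}
    (hc : P.CutAt st.optCuts st.feasCuts c₀) : P.CutAt st'.optCuts st'.feasCuts c₀ := by
  cases h with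
  | optimality w mu ub c solved feas gap master =>
    exact hc.imp_left fun ⟨k, hk, hs⟩ => ⟨k, List.mem_cons_of_mem _ hk, hs⟩
  | feasibility g w lm ub c infeas solved master =>
    exact hc.imp_right fun ⟨hb, k, hk, hs⟩ => ⟨hb, k, List.mem_cons_of_mem _ hk, hs⟩

theorem ereal_sub_le_self (a : EReal) {ε : ℝ} (hε : 0 ≤ ε) : a - (ε : EReal) ≤ a := by
  simpa using EReal.sub_le_sub (le_refl a) (EReal.coe_nonneg.2 hε)

/-- No iteration starts from a master solution at which a cut was generated before. -/
theorem Step.not_cutAt {ε : ℝ} (hε : 0 ≤ ε) {st st' : State E S} (h : P.Step ε st st')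
    (hm : P.MasterSolved st.optCuts st.feasCuts st.UB st.c) :
    ¬ P.CutAt st.optCuts st.feasCuts st.c := by
  rintro (⟨k, hk, hs⟩ | ⟨hb, k, hk, g, hs⟩)
  · have hUB := hm.1.2.1 k hk
    -- Tightness of the old cut turns the master constraint into `UB ≤ f - P_str` at the current
    -- point, so the stopping test holds for any `ε ≥ 0`.
    rw [hs.LUpper_self, EReal.coe_sub, ← hs.innerVal_eq] at hUB
    cases h with
    | optimality w mu ub c solved feas gap master =>
      exact absurd ((ereal_sub_le_self _ hε).trans hUB) (not_le.2 gap)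
    | feasibility g w lm ub c infeas solved master =>
      rw [innerVal_eq_bot] at infeas
      exact Set.notMem_empty k.1 (infeas ▸ hs.mem)
  · exact absurd (hm.1.2.2 k hk) (not_le.2 (hs.LLower_self (innerVal_eq_bot.1 hb)))

/-! ### Executions: iteration bound, progress and correctness of the output. -/

variable {ε : ℝ} {k : ℕ} {run : ℕ → State E S}

theorem IsRun.cutsValid (h : P.IsRun ε k run) {i : ℕ} (hi : i ≤ k) :
    P.CutsValid (run i).optCuts (run i).feasCuts := by
  induction i with
  | zero => simp [CutsValid, h.1.2.2.1, h.1.2.2.2]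
  | succ i ih => exact (h.2 i hi).cutsValid (ih (Nat.le_of_succ_le hi))

theorem IsRun.masterSolved (h : P.IsRun ε k run) {i : ℕ} (hi : i ≤ k) (h0 : i ≠ 0) :
    P.MasterSolved (run i).optCuts (run i).feasCuts (run i).UB (run i).c := by
  obtain ⟨j, rfl⟩ := Nat.exists_eq_succ_of_ne_zero h0
  exact (h.2 j hi).masterSolved

theorem IsRun.cutAt (h : P.IsRun ε k run) {i j : ℕ} (hij : i < j) (hj : j ≤ k) :
    P.CutAt (run j).optCuts (run j).feasCuts (run i).c := by
  induction j, hij using Nat.le_induction with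
  | base => exact (h.2 i hj).cutAt
  | succ j hij ih => exact (h.2 j hj).cutAt_of_cutAt (ih (Nat.le_of_succ_le hj))

/-- Pigeonhole: the binary points of `run 0, …, run (k - 1)`, from which a step was made, are
pairwise distinct. The last point `(run k).c` may be a repetition, so it is not counted. In each
pair the later state has positive index and is thus a master solution, so the arbitrary initial
point does no harm. -/
theorem IsRun.le_card (hε : 0 ≤ ε) (h : P.IsRun ε k run) : k ≤ Nat.card (Compl E S) := by
  have hne : ∀ i j : Fin k, i < j → (run i).c ≠ (run j).c := fun i j hij he =>
    (h.2 j j.2).not_cutAt hε (h.masterSolved j.2.le (Nat.ne_zero_of_lt hij))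
      (he ▸ h.cutAt hij j.2.le)
  have hinj : Function.Injective fun i : Fin k => (run i).c := fun i j he => by
    rcases lt_trichotomy i j with hij | hij | hij
    · exact absurd he (hne i j hij)
    · exact hij
    · exact absurd he.symm (hne j i hij)
  simpa using Nat.card_le_card_of_injective _ hinj

theorem IsRun.profit_le_UB (h : P.IsRun ε k run) {c : Compl E S} {w : Simp E S}
    (hcw : P.Feasible c w) : (P.profit c w : EReal) ≤ (run k).UB := by
  rcases Nat.eq_zero_or_pos k with rfl | hk
  · rw [h.1.1]; exact le_top
  · exact (h.masterSolved le_rfl hk.ne').2 _ _ ((h.cutsValid le_rfl).masterFeasible hcw)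

theorem IsRun.halts_or_step (h : P.IsRun ε k run) :
    (∃ c w, P.Halts ε (run k) c w) ∨ ∃ st, P.Step ε (run k) st := by
  have hv := h.cutsValid le_rfl
  rcases Set.eq_empty_or_nonempty (P.innerSet (run k).c) with he | hne
  · obtain ⟨g, w, lm, hs⟩ := P.exists_feasSolved he
    obtain ⟨ub, c, hm⟩ := CutsValid.exists_masterSolved
      (P := P) (oc := (run k).optCuts) (fc := (w, lm) :: (run k).feasCuts)
      ⟨hv.1, List.forall_mem_cons.2 ⟨⟨_, _, hs⟩, hv.2⟩⟩
    exact .inr ⟨_, .feasibility _ g w lm ub c (innerVal_eq_bot.2 he) hs hm⟩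
  · obtain ⟨w, mu, hs⟩ := P.exists_innerSolved hne
    by_cases hgap : (run k).UB - (ε : EReal)
        ≤ P.innerVal (run k).c - (P.strCost (run k).c : EReal)
    · exact .inl ⟨_, w, rfl, ⟨mu, hs⟩, hgap, by rw [hs.innerVal_eq]; exact EReal.coe_lt_top _⟩
    · obtain ⟨ub, c, hm⟩ := CutsValid.exists_masterSolved
        (P := P) (oc := (w, mu) :: (run k).optCuts) (fc := (run k).feasCuts)
        ⟨List.forall_mem_cons.2 ⟨⟨_, hs⟩, hv.1⟩, hv.2⟩
      exact .inr ⟨_, .optimality _ w mu ub c hs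
        (by rw [hs.innerVal_eq]; exact EReal.bot_lt_coe _) (not_le.1 hgap) hm⟩

theorem Halts.UB_le {st : State E S} {c : Compl E S} {w : Simp E S} (h : P.Halts ε st c w) :
    st.UB ≤ ((P.profit c w + ε : ℝ) : EReal) := by
  obtain ⟨rfl, ⟨mu, hs⟩, hgap, -⟩ := h
  rw [hs.innerVal_eq, ← EReal.coe_sub] at hgap
  rw [EReal.coe_add]
  exact (EReal.sub_le_iff_le_add (.inl (EReal.coe_ne_bot _)) (.inl (EReal.coe_ne_top _))).1 hgap

/-- The initial point need not be admissible, but the algorithm cannot stop there: `UB = ⊤` then,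
while stopping bounds `UB` by a real number. Any later point solves a master problem and is
therefore admissible. -/
theorem IsRun.feasible_of_halts (h : P.IsRun ε k run) {c : Compl E S} {w : Simp E S}
    (hh : P.Halts ε (run k) c w) : P.Feasible c w := by
  have hUB := hh.UB_le
  obtain ⟨rfl, ⟨mu, hs⟩, -, -⟩ := hh
  refine ⟨?_, hs.mem⟩
  rcases Nat.eq_zero_or_pos k with rfl | hk
  · rw [h.1.1] at hUB
    exact absurd hUB (not_le.2 (EReal.coe_lt_top _))
  · exact (h.masterSolved le_rfl hk.ne').1.1

end Params

end MEC

/-- For every tolerance `ε ≥ 0`, the number of iterations of all executions is bounded; an execution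
never gets stuck before stopping (all subproblems it has to solve are solvable); and when it stops,
its output is feasible, `ε`-optimal and bracketed by the upper bound, hence a global optimum with
`UB` the optimal value if `ε = 0`. -/
theorem theorem2 {E S : ℕ} (P : MEC.Params E S) (ε : ℝ) (hε : 0 ≤ ε) :
    ∃ N : ℕ, ∀ (k : ℕ) (run : ℕ → MEC.State E S), P.IsRun ε k run →
      k ≤ N ∧
      ((∃ c w, P.Halts ε (run k) c w) ∨ ∃ st, P.Step ε (run k) st) ∧
      ∀ c w, P.Halts ε (run k) c w →
        P.Feasible c w ∧
        (∀ c' w', P.Feasible c' w' →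
          (P.profit c' w' : EReal) ≤ (run k).UB ∧ P.profit c' w' ≤ P.profit c w + ε) ∧
        (ε = 0 → P.IsGlobalOptimum c w ∧ (run k).UB = (P.profit c w : EReal)) := by
  refine ⟨Nat.card (MEC.Compl E S), fun k run h => ⟨h.le_card hε, h.halts_or_step,
    fun c w hh => ?_⟩⟩
  have hf := h.feasible_of_halts hh
  have hle : ∀ c' w', P.Feasible c' w' → P.profit c' w' ≤ P.profit c w + ε := fun c' w' h' =>
    EReal.coe_le_coe_iff.1 ((h.profit_le_UB h').trans hh.UB_le)
  refine ⟨hf, fun c' w' h' => ⟨h.profit_le_UB h', hle c' w' h'⟩, ?_⟩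
  rintro rfl
  exact ⟨⟨hf, fun c' w' h' => by simpa using hle c' w' h'⟩,
    le_antisymm (by simpa using hh.UB_le) (h.profit_le_UB hf)⟩
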